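/- Let $G$ be a finite group and let $\omega\in Z^3(G,\mathrm{U}(1))$ be a normalized 3-cocycle for the trivial action: $\omega:G^3\to \mathrm{U}(1)$, $\omega(g,h,k)=1$ whenever one of $g,h,k$ is $1$, and $$\omega(h,k,l)\,\omega(g,hk,l)\,\omega(g,h,k)=\omega(gh,k,l)\,\omega(g,h,kl)\qquad(g,h,k,l\in G).$$ An *$\omega$-anomalous action* of $G$ on a C*-algebra $B$ consists of $*$-automorphisms $\alpha_g\in\mathrm{Aut}(B)$ ($g\in G$) and unitaries $m_{g,h}\in M(B)$ ($g,h\in G$) in the multiplier algebra such that, for all $g,h,k\in G$ and $x\in B$, $$m_{g,h}\,\alpha_g(\alpha_h(x))=\alpha_{gh}(x)\,m_{g,h},\qquad \omega(g,h,k)\,m_{gh,k}\,m_{g,h}=m_{g,hk}\,\alpha_g(m_{h,k}),$$ where $\alpha_g$ is extended to $M(B)$. A metric space has *bounded geometry* if for every $R>0$ there is $N$ such that every $R$-ball has at most $N$ elements. For such a space $X$ and a complex Hilbert space $H$, let $P_x$ ($x\in X$) be the projection of $\ell^2(X,H)$ onto the functions supported at $x$. An operator $T\in B(\ell^2(X,H))$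 is *locally compact* if every $P_yTP_x$ is compact, and has *finite propagation* if there is $R>0$ such that $P_yTP_x\neq0$ implies $d(x,y)<R$. For $H$ separable and infinite-dimensional, the Roe algebra $C^*(X)$ is the norm closure of the locally compact operators of finite propagation. For $H=\mathbb{C}$ (where local compactness is automatic) the same closure is the uniform Roe algebra $C^*_u(X)$. Write $\mathcal{K}$ for the ideal of compact operators. The Roe corona is $C^*(X)/\mathcal{K}$, and the uniform Roe corona is $C^*_u(X)/\mathcal{K}$. Let $(Y,d)$ be a metric space with bounded geometry and $y_0\in Y$. Let $X$ be the wedge of copies $Y_g$ ($g\in G$) of $Y$, glued together at $y_0$, with the metric that equals $d$ on each copy and equals $d(x,y_0)+d(y_0,y)$ for $x\in Y_g$, $y\in Y_h$, $g\neq h$. The group $G$ acts on $X$ by the isometries $g\cdot y_h=y_{gh}$ for $y\in Y\setminus\{y_0\}$, and $g\cdot y_0=y_0$, where $y_h$ is the point $y$ of the copy $Y_h$. Put $(U_g\eta)(x)=\eta(g^{-1}x)$ for $\eta\in\ell^2(X,H)$. Then $a\mapsto U_gaU_g^*$ preserves $C^*(X)$ and $\mathcal{K}$; let $\alpha_g([a])=[U_gaU_g^*]$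 be the induced automorphism of $C^*(X)/\mathcal{K}$. For $g,h\in G$ let $m_{g,h}$ be the diagonal unitary $$(m_{g,h}\eta)(x)=\begin{cases}\omega(g,h,h^{-1}g^{-1}k)^{-1}\,\eta(x), & x\in Y_k\setminus\{y_0\},\\ \eta(x), & x=y_0,\end{cases}$$ and let $[m_{g,h}]\in M(C^*(X)/\mathcal{K})$ be the multiplier $[a]\mapsto[m_{g,h}a]$, $[a]\mapsto[a\,m_{g,h}]$. Then $g\mapsto\alpha_g$ together with the elements $[m_{g,h}]$ is an $\omega$-anomalous action of $G$ on the Roe corona $C^*(X)/\mathcal{K}$. With $H=\mathbb{C}$, the same formulas define an $\omega$-anomalous action of $G$ on the uniform Roe corona $C^*_u(X)/\mathcal{K}$. -/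

import Mathlib

noncomputable section

namespace Coarse

open scoped MultiplierAlgebra

/-! ## Quotients of C*-algebras by closed ideals -/

/-- A closed, self-adjoint, two-sided ideal of a (not necessarily unital) C*-algebra. -/
structure ClosedIdeal (A : Type*) [NonUnitalCStarAlgebra A] extends Submodule ℂ A where
  ofSubmodule ::
  mul_mem_left' : ∀ (a : A) {x : A}, x ∈ carrier → a * x ∈ carrier
  mul_mem_right' : ∀ (a : A) {x : A}, x ∈ carrier → x * a ∈ carrier
  star_mem' : ∀ {x : A}, x ∈ carrier → star x ∈ carrier
  isClosed' : IsClosed carrier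

namespace ClosedIdeal

variable {A : Type*} [NonUnitalCStarAlgebra A] (I : ClosedIdeal A)

/-- The quotient `A / I`, with the quotient norm, product and involution. -/
def Quotient : Type _ := A ⧸ I.toSubmodule

instance instIsClosed : IsClosed (I.toSubmodule : Set A) := I.isClosed'

instance : NormedAddCommGroup I.Quotient :=
  inferInstanceAs (NormedAddCommGroup (A ⧸ I.toSubmodule))

instance : NormedSpace ℂ I.Quotient :=
  inferInstanceAs (NormedSpace ℂ (A ⧸ I.toSubmodule))

instance : CompleteSpace I.Quotient :=
  inferInstanceAs (CompleteSpace (A ⧸ I.toSubmodule))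

/-- The quotient map `A → A / I`, as a linear map. -/
def mk : A →ₗ[ℂ] I.Quotient := I.toSubmodule.mkQ

variable {I}

theorem mk_surjective : Function.Surjective I.mk := Submodule.mkQ_surjective _

theorem mk_eq_mk {a b : A} : I.mk a = I.mk b ↔ a - b ∈ I.toSubmodule :=
  Submodule.Quotient.eq _

theorem norm_mk_le (a : A) : ‖I.mk a‖ ≤ ‖a‖ := Submodule.Quotient.norm_mk_le _ a

theorem exists_norm_lt (x : I.Quotient) {ε : ℝ} (hε : 0 < ε) :
    ∃ a, I.mk a = x ∧ ‖a‖ < ‖x‖ + ε :=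
  Submodule.Quotient.norm_mk_lt (S := I.toSubmodule) x hε

instance : Mul I.Quotient where
  mul := Quotient.map₂ (· * ·) (by
    intro a a' ha b b' hb
    have ha := (Submodule.quotientRel_def _).1 ha
    have hb := (Submodule.quotientRel_def _).1 hb
    refine (Submodule.quotientRel_def _).2 ?_
    have h : a * b - a' * b' = (a - a') * b + a' * (b - b') := by noncomm_ring
    rw [h]
    exact I.toSubmodule.add_mem (I.mul_mem_right' _ ha) (I.mul_mem_left' _ hb))

instance : Star I.Quotient where
  star := Quotient.map star (by
    intro a b h
    have h := (Submodule.quotientRel_def _).1 h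
    refine (Submodule.quotientRel_def _).2 ?_
    rw [← star_sub]
    exact I.star_mem' h)

@[simp] theorem mk_mul (a b : A) : I.mk (a * b) = I.mk a * I.mk b := rfl
@[simp] theorem mk_star (a : A) : I.mk (star a) = star (I.mk a) := rfl

instance : NonUnitalRing I.Quotient where
  left_distrib x y z := by
    obtain ⟨a, rfl⟩ := mk_surjective x
    obtain ⟨b, rfl⟩ := mk_surjective y
    obtain ⟨c, rfl⟩ := mk_surjective z
    simp only [← mk_mul, ← map_add, mul_add]
  right_distrib x y z := by
    obtain ⟨a, rfl⟩ := mk_surjective x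
    obtain ⟨b, rfl⟩ := mk_surjective y
    obtain ⟨c, rfl⟩ := mk_surjective z
    simp only [← mk_mul, ← map_add, add_mul]
  zero_mul x := by
    obtain ⟨a, rfl⟩ := mk_surjective x
    rw [← map_zero I.mk, ← mk_mul, zero_mul]
  mul_zero x := by
    obtain ⟨a, rfl⟩ := mk_surjective x
    rw [← map_zero I.mk, ← mk_mul, mul_zero]
  mul_assoc x y z := by
    obtain ⟨a, rfl⟩ := mk_surjective x
    obtain ⟨b, rfl⟩ := mk_surjective y
    obtain ⟨c, rfl⟩ := mk_surjective z
    simp only [← mk_mul, mul_assoc]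

instance : NonUnitalNormedRing I.Quotient where
  dist_eq x y := NormedAddGroup.dist_eq x y
  norm_mul_le x y := by
    refine le_of_forall_pos_le_add fun ε hε => ?_
    have hlim : Filter.Tendsto (fun δ : ℝ => (‖x‖ + δ) * (‖y‖ + δ)) (nhdsWithin 0 (Set.Ioi 0))
        (nhds (‖x‖ * ‖y‖)) := by
      refine Filter.Tendsto.mono_left ?_ nhdsWithin_le_nhds
      have : Continuous fun δ : ℝ => (‖x‖ + δ) * (‖y‖ + δ) := by fun_prop
      simpa using this.tendsto 0
    have h1 := hlim.eventually (gt_mem_nhds (lt_add_of_pos_right (‖x‖ * ‖y‖) hε))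
    obtain ⟨δ, h2, hδ⟩ := (h1.and self_mem_nhdsWithin).exists
    obtain ⟨a, ha, hna⟩ := exists_norm_lt x hδ
    obtain ⟨b, hb, hnb⟩ := exists_norm_lt y hδ
    calc ‖x * y‖ = ‖I.mk (a * b)‖ := by rw [mk_mul, ha, hb]
      _ ≤ ‖a * b‖ := norm_mk_le _
      _ ≤ ‖a‖ * ‖b‖ := norm_mul_le _ _
      _ ≤ (‖x‖ + δ) * (‖y‖ + δ) := by gcongr
      _ ≤ _ := h2.le

instance : StarRing I.Quotient where
  star_involutive x := by
    obtain ⟨a, rfl⟩ := mk_surjective x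
    simp only [← mk_star, star_star]
  star_mul x y := by
    obtain ⟨a, rfl⟩ := mk_surjective x
    obtain ⟨b, rfl⟩ := mk_surjective y
    simp only [← mk_star, ← mk_mul, star_mul]
  star_add x y := by
    obtain ⟨a, rfl⟩ := mk_surjective x
    obtain ⟨b, rfl⟩ := mk_surjective y
    simp only [← mk_star, ← map_add, star_add]

/-- A closed ideal, as a C*-subalgebra. -/
def toNonUnitalStarSubalgebra : NonUnitalStarSubalgebra ℂ A where
  carrier := I.carrier
  zero_mem' := I.zero_mem'
  add_mem' := I.add_mem'
  smul_mem' := I.smul_mem'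
  mul_mem' := fun {a} _ _ hb => I.mul_mem_left' a hb
  star_mem' := I.star_mem'

open scoped CStarAlgebra in
/-- Elements of a closed ideal are approximately fixed by contractions `e ∈ I` for which
`x ↦ x - x e` is contractive. -/
theorem exists_approx (b : A) (hb : b ∈ I.toSubmodule) {ε : ℝ} (hε : 0 < ε) :
    ∃ e ∈ I.toSubmodule, (∀ x : A, ‖x - x * e‖ ≤ ‖x‖) ∧ ‖b - b * e‖ ≤ ε := by
  let S : NonUnitalStarSubalgebra ℂ A := I.toNonUnitalStarSubalgebra
  have : IsClosed (S : Set A) := I.isClosed'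
  let : NonUnitalCStarAlgebra S := NonUnitalStarSubalgebra.nonUnitalCStarAlgebra S
  let : PartialOrder S := CStarAlgebra.spectralOrder S
  let : StarOrderedRing S := CStarAlgebra.spectralOrderedRing S
  have hu := CStarAlgebra.increasingApproximateUnit S
  have h1 := hu.tendsto_mul_left ⟨b, hb⟩
  have h2 := (Metric.tendsto_nhds.1 h1 ε hε)
  obtain ⟨e, ⟨he0, he1⟩, he2⟩ := ((hu.eventually_nonneg.and hu.eventually_norm).and h2).exists
  refine ⟨e, e.2, fun x => ?_, ?_⟩
  · let : PartialOrder A := CStarAlgebra.spectralOrder A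
    let : StarOrderedRing A := CStarAlgebra.spectralOrderedRing A
    have he0' : (0 : A) ≤ (e : A) := by
      obtain ⟨c, hc⟩ := CStarAlgebra.nonneg_iff_eq_star_mul_self.1 he0
      rw [hc]
      exact star_mul_self_nonneg (c : A)
    have he1' : ‖((e : A) : Unitization ℂ A)‖ ≤ 1 := by
      rw [Unitization.norm_inr]; exact he1
    have hmem : ((e : A) : Unitization ℂ A) ∈ Set.Icc 0 1 :=
      CStarAlgebra.mem_Icc_iff_norm_le_one.mpr
        ⟨Unitization.inr_nonneg_iff.2 he0', he1'⟩
    have hmem' := Set.sub_mem_Icc_zero_iff_right.mpr hmem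
    have h3 : ‖(1 : Unitization ℂ A) - ((e : A) : Unitization ℂ A)‖ ≤ 1 :=
      (CStarAlgebra.mem_Icc_iff_norm_le_one.mp hmem').2
    calc ‖x - x * e‖ = ‖(x : Unitization ℂ A) * (1 - ((e : A) : Unitization ℂ A))‖ := by
          rw [← Unitization.norm_inr (𝕜 := ℂ), Unitization.inr_sub, Unitization.inr_mul, mul_sub,
            mul_one]
      _ ≤ ‖(x : Unitization ℂ A)‖ * ‖1 - ((e : A) : Unitization ℂ A)‖ := norm_mul_le _ _
      _ ≤ ‖(x : Unitization ℂ A)‖ * 1 := by gcongr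
      _ = ‖x‖ := by rw [mul_one, Unitization.norm_inr]
  · rw [dist_comm, dist_eq_norm] at he2
    exact he2.le

instance : CStarRing I.Quotient where
  norm_mul_self_le x := by
    obtain ⟨a, rfl⟩ := mk_surjective x
    refine le_of_forall_pos_le_add fun ε hε => ?_
    obtain ⟨c, hc, hnc⟩ := exists_norm_lt (star (I.mk a) * I.mk a) (half_pos hε)
    rw [← mk_star, ← mk_mul, mk_eq_mk] at hc
    obtain ⟨e, heI, he, hb⟩ := exists_approx _ hc (half_pos hε)
    have hmk : I.mk a = I.mk (a - a * e) := by
      rw [mk_eq_mk, sub_sub_cancel]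
      exact I.mul_mem_left' _ heI
    have hcontr : ∀ y : A, ‖y - star e * y‖ ≤ ‖y‖ := fun y => by
      have := he (star y)
      rwa [← norm_star, star_sub, star_mul, star_star, norm_star] at this
    have hid : star (a - a * e) * (a - a * e) =
        (star a * a - star e * (star a * a)) - (star a * a - star e * (star a * a)) * e := by
      rw [star_sub, star_mul]; noncomm_ring
    set y := star a * a with hy
    have hsplit : (y - star e * y) - (y - star e * y) * e =
        ((c - star e * c) - (c - star e * c) * e) -
        (((c - y) - (c - y) * e) - star e * ((c - y) - (c - y) * e)) := by
      noncomm_ring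
    calc ‖I.mk a‖ * ‖I.mk a‖ ≤ ‖a - a * e‖ * ‖a - a * e‖ := by
          rw [hmk]; gcongr <;> exact norm_mk_le _
      _ = ‖(y - star e * y) - (y - star e * y) * e‖ := by
          rw [← CStarRing.norm_star_mul_self, hid]
      _ ≤ ‖(c - star e * c) - (c - star e * c) * e‖ +
          ‖((c - y) - (c - y) * e) - star e * ((c - y) - (c - y) * e)‖ := by
          rw [hsplit]; exact norm_sub_le _ _
      _ ≤ ‖c‖ + ε / 2 := by
          gcongr
          · exact (he _).trans (hcontr _)
          · exact (hcontr _).trans hb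
      _ ≤ ‖star (I.mk a) * I.mk a‖ + ε := by linarith

instance : NonUnitalCStarAlgebra I.Quotient where
  smul_assoc c x y := by
    obtain ⟨a, rfl⟩ := mk_surjective x
    obtain ⟨b, rfl⟩ := mk_surjective y
    simp only [smul_eq_mul, ← map_smul, ← mk_mul, smul_mul_assoc]
  smul_comm c x y := by
    obtain ⟨a, rfl⟩ := mk_surjective x
    obtain ⟨b, rfl⟩ := mk_surjective y
    simp only [smul_eq_mul, ← map_smul, ← mk_mul, mul_smul_comm]
  star_smul c x := by
    obtain ⟨a, rfl⟩ := mk_surjective x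
    simp only [← map_smul, ← mk_star, star_smul]

/-- The automorphism of `A / I` induced by an automorphism of `A` that maps `I` onto `I`. -/
def mapEquiv (φ : A ≃⋆ₐ[ℂ] A) (h : ∀ a, φ a ∈ I.toSubmodule ↔ a ∈ I.toSubmodule) :
    I.Quotient ≃⋆ₐ[ℂ] I.Quotient where
  toFun := Quotient.map φ (by
    intro a b hab
    have hab := (Submodule.quotientRel_def _).1 hab
    refine (Submodule.quotientRel_def _).2 ?_
    rw [← map_sub]; exact (h _).2 hab)
  invFun := Quotient.map φ.symm (by
    intro a b hab
    have hab := (Submodule.quotientRel_def _).1 hab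
    refine (Submodule.quotientRel_def _).2 ?_
    rw [← map_sub, ← h, StarAlgEquiv.apply_symm_apply]; exact hab)
  left_inv x := by
    obtain ⟨a, rfl⟩ := mk_surjective x
    exact congrArg I.mk (φ.symm_apply_apply a)
  right_inv x := by
    obtain ⟨a, rfl⟩ := mk_surjective x
    exact congrArg I.mk (φ.apply_symm_apply a)
  map_mul' x y := by
    obtain ⟨a, rfl⟩ := mk_surjective x
    obtain ⟨b, rfl⟩ := mk_surjective y
    exact congrArg I.mk (map_mul φ a b)
  map_add' x y := by
    obtain ⟨a, rfl⟩ := mk_surjective x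
    obtain ⟨b, rfl⟩ := mk_surjective y
    exact congrArg I.mk (map_add φ a b)
  map_star' x := by
    obtain ⟨a, rfl⟩ := mk_surjective x
    exact congrArg I.mk (map_star φ a)
  map_smul' c x := by
    obtain ⟨a, rfl⟩ := mk_surjective x
    exact congrArg I.mk (map_smul φ c a)

@[simp] theorem mapEquiv_mk (φ : A ≃⋆ₐ[ℂ] A)
    (h : ∀ a, φ a ∈ I.toSubmodule ↔ a ∈ I.toSubmodule) (a : A) :
    mapEquiv φ h (I.mk a) = I.mk (φ a) := rfl

/-- The bounded operator on `A / I` induced by a bounded operator on `A` that preserves `I`. -/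
def mapCLM (L : A →L[ℂ] A) (h : ∀ a ∈ I.toSubmodule, L a ∈ I.toSubmodule) :
    I.Quotient →L[ℂ] I.Quotient :=
  LinearMap.mkContinuous (E := I.Quotient) (F := I.Quotient)
    (Submodule.mapQ I.toSubmodule I.toSubmodule (L : A →ₗ[ℂ] A) h) ‖L‖ (by
    intro x
    refine le_of_forall_pos_le_add fun ε hε => ?_
    have hp : 0 < ‖L‖ + 1 := by positivity
    obtain ⟨a, rfl, ha⟩ := exists_norm_lt x (div_pos hε hp)
    calc ‖I.mk (L a)‖ ≤ ‖L a‖ := norm_mk_le _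
      _ ≤ ‖L‖ * ‖a‖ := L.le_opNorm a
      _ ≤ ‖L‖ * (‖I.mk a‖ + ε / (‖L‖ + 1)) := by gcongr
      _ = ‖L‖ * ‖I.mk a‖ + ‖L‖ / (‖L‖ + 1) * ε := by ring
      _ ≤ ‖L‖ * ‖I.mk a‖ + 1 * ε := by
          gcongr
          rw [div_le_one hp]; linarith
      _ = _ := by rw [one_mul])

@[simp] theorem mapCLM_mk (L : A →L[ℂ] A) (h : ∀ a ∈ I.toSubmodule, L a ∈ I.toSubmodule) (a : A) :
    mapCLM L h (I.mk a) = I.mk (L a) := rfl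

/-- The multiplier of `A / I` induced by a multiplier of `A` that preserves `I`. -/
def mapMultiplier (M : 𝓜(ℂ, A)) (hl : ∀ a ∈ I.toSubmodule, M.fst a ∈ I.toSubmodule)
    (hr : ∀ a ∈ I.toSubmodule, M.snd a ∈ I.toSubmodule) : 𝓜(ℂ, I.Quotient) where
  fst := mapCLM M.fst hl
  snd := mapCLM M.snd hr
  central x y := by
    obtain ⟨a, rfl⟩ := mk_surjective x
    obtain ⟨b, rfl⟩ := mk_surjective y
    simp only [mapCLM_mk, ← mk_mul, M.central]

end ClosedIdeal

/-! ## Anomalous actions -/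

/-- A *-automorphism of a C*-algebra, as a bounded operator. -/
def autCLM {B : Type*} [NonUnitalCStarAlgebra B] (φ : B ≃⋆ₐ[ℂ] B) : B →L[ℂ] B where
  toFun := φ
  map_add' := map_add φ
  map_smul' := map_smul φ
  cont := (NonUnitalStarAlgHom.isometry φ φ.injective).continuous

/-- The (unique) extension of a *-automorphism of a C*-algebra to its multiplier algebra: it sends
the multiplier `M` to `b ↦ φ (M (φ⁻¹ b))`, on both sides. -/
def multiplierExt {B : Type*} [NonUnitalCStarAlgebra B] (φ : B ≃⋆ₐ[ℂ] B) (M : 𝓜(ℂ, B)) :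
    𝓜(ℂ, B) where
  fst := autCLM φ ∘L M.fst ∘L autCLM φ.symm
  snd := autCLM φ ∘L M.snd ∘L autCLM φ.symm
  central x y := by
    have h := congrArg φ (M.central (φ.symm x) (φ.symm y))
    rw [map_mul, map_mul, φ.apply_symm_apply, φ.apply_symm_apply] at h
    exact h

/-- The extension of `φ` to the multiplier algebra restricts to `φ`. -/
theorem multiplierExt_coe {B : Type*} [NonUnitalCStarAlgebra B] (φ : B ≃⋆ₐ[ℂ] B) (b : B) :
    multiplierExt φ (b : 𝓜(ℂ, B)) = (φ b : B) := by
  refine DoubleCentralizer.ext _ _ _ _ (Prod.ext ?_ ?_) <;> ext x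
  · change φ (b * φ.symm x) = φ b * x
    rw [map_mul, φ.apply_symm_apply]
  · change φ (φ.symm x * b) = x * φ b
    rw [map_mul, φ.apply_symm_apply]

/-- Normalized 3-cocycles of `G` with values in `U(1)` (trivial action), written
multiplicatively. -/
structure IsNormalizedThreeCocycle {G : Type*} [Group G] (ω : G → G → G → Circle) : Prop where
  one_left : ∀ h k, ω 1 h k = 1
  one_mid : ∀ g k, ω g 1 k = 1
  one_right : ∀ g h, ω g h 1 = 1
  cocycle : ∀ g h k l,
    ω h k l * ω g (h * k) l * ω g h k = ω (g * h) k l * ω g h (k * l)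

/-- `g ↦ α g` together with `(g, h) ↦ m g h` is an `ω`-anomalous action of `G` on the
C*-algebra `B`. -/
structure IsAnomalousAction {G : Type*} [Group G] (ω : G → G → G → Circle)
    {B : Type*} [NonUnitalCStarAlgebra B] (α : G → B ≃⋆ₐ[ℂ] B) (m : G → G → 𝓜(ℂ, B)) : Prop where
  unitary : ∀ g h, m g h ∈ unitary 𝓜(ℂ, B)
  intertwine : ∀ (g h : G) (x : B),
    m g h * (α g (α h x) : B) = (α (g * h) x : B) * m g h
  anomaly : ∀ g h k : G,
    (ω g h k : ℂ) • (m (g * h) k * m g h) = m g (h * k) * multiplierExt (α g) (m h k)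


/-! ## Operators on `ℓ²(X, H)` -/

set_option linter.unusedSectionVars false

section Operators

variable (X : Type*) (H : Type*) [NormedAddCommGroup H] [InnerProductSpace ℂ H] [CompleteSpace H]

/-- The Hilbert space `ℓ²(X, H)`. -/
abbrev L2 := lp (fun _ : X => H) 2

/-- The bounded operators on `ℓ²(X, H)`. -/
abbrev Op := L2 X H →L[ℂ] L2 X H

variable {X H}


variable (H) in
/-- The diagonal operator `(D η)(x) = f(x) η(x)`, for a function `f` bounded by 1. -/
def diagonalOp (f : X → ℂ) (hf : ∀ x, ‖f x‖ ≤ 1) : Op X H :=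
  LinearMap.mkContinuous
    { toFun := fun η => ⟨fun x => f x • η x, (lp.memℓp η).mono' fun x => by
        rw [norm_smul]; exact mul_le_of_le_one_left (norm_nonneg _) (hf x)⟩
      map_add' := fun η ξ => by ext x; exact smul_add _ _ _
      map_smul' := fun c η => by ext x; exact smul_comm _ _ _ } 1
    (fun η => by
      rw [one_mul]
      refine lp.norm_mono two_ne_zero fun x => ?_
      change ‖f x • η x‖ ≤ _
      rw [norm_smul]; exact mul_le_of_le_one_left (norm_nonneg _) (hf x))

@[simp] theorem diagonalOp_apply (f : X → ℂ) (hf : ∀ x, ‖f x‖ ≤ 1) (η : L2 X H) (x : X) :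
    diagonalOp H f hf η x = f x • η x := rfl

variable (H) in
/-- The permutation unitary `(U η)(x) = η(σ⁻¹ x)`. -/
def permOp (σ : X ≃ X) : Op X H :=
  LinearMap.mkContinuous
    { toFun := fun η => ⟨fun x => η (σ.symm x), by
        have h := (memℓp_gen_iff (p := 2) (by norm_num)).1 (lp.memℓp η)
        exact (memℓp_gen_iff (p := 2) (by norm_num)).2 (h.comp_injective σ.symm.injective)⟩
      map_add' := fun η ξ => by ext x; rfl
      map_smul' := fun c η => by ext x; rfl } 1
    (fun η => by
      have h0 : 0 < (2 : ENNReal).toReal := by norm_num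
      rw [one_mul, lp.norm_eq_tsum_rpow h0, lp.norm_eq_tsum_rpow h0]
      exact le_of_eq (congrArg (· ^ (1 / (2 : ENNReal).toReal))
        (σ.symm.tsum_eq (fun x => ‖η x‖ ^ (2 : ENNReal).toReal))))

@[simp] theorem permOp_apply (σ : X ≃ X) (η : L2 X H) (x : X) :
    permOp H σ η x = η (σ.symm x) := rfl

theorem star_diagonalOp (f : X → ℂ) (hf : ∀ x, ‖f x‖ ≤ 1) :
    star (diagonalOp H f hf : Op X H) = diagonalOp H (fun x => star (f x)) (by simpa using hf) := by
  rw [ContinuousLinearMap.star_eq_adjoint, eq_comm, ContinuousLinearMap.eq_adjoint_iff]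
  intro η ξ
  rw [lp.inner_eq_tsum, lp.inner_eq_tsum]
  refine tsum_congr fun x => ?_
  simp [inner_smul_left, inner_smul_right]

theorem star_permOp (σ : X ≃ X) : star (permOp H σ : Op X H) = permOp H σ.symm := by
  rw [ContinuousLinearMap.star_eq_adjoint, eq_comm, ContinuousLinearMap.eq_adjoint_iff]
  intro η ξ
  rw [lp.inner_eq_tsum, lp.inner_eq_tsum, ← σ.tsum_eq (fun x => inner ℂ (η x) (permOp H σ ξ x))]
  refine tsum_congr fun x => ?_
  rw [permOp_apply, permOp_apply, Equiv.symm_symm, σ.symm_apply_apply]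

theorem permOp_mul_symm (σ : X ≃ X) : permOp H σ * permOp H σ.symm = (1 : Op X H) := by
  ext η x; simp

theorem permOp_symm_mul (σ : X ≃ X) : permOp H σ.symm * permOp H σ = (1 : Op X H) := by
  ext η x; simp

variable (H) in
open scoped Classical in
/-- The projection `P_x` onto the functions supported at the point `x`. -/
def pointProj (x : X) : Op X H :=
  diagonalOp H (fun z => if z = x then 1 else 0) (fun z => by split_ifs <;> simp)

theorem pointProj_apply_self (x : X) (η : L2 X H) : pointProj H x η x = η x := by
  simp [pointProj]

theorem pointProj_apply_ne {x z : X} (h : z ≠ x) (η : L2 X H) : pointProj H x η z = 0 := by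
  simp [pointProj, h]

theorem pointProj_mul_self (x : X) : pointProj H x * pointProj H x = (pointProj H x : Op X H) := by
  ext η z
  by_cases h : z = x
  · subst h; simp [pointProj_apply_self]
  · simp [pointProj_apply_ne h]

theorem star_pointProj (x : X) : star (pointProj H x : Op X H) = pointProj H x := by
  rw [pointProj, star_diagonalOp]
  congr 1
  ext z
  split_ifs <;> simp

theorem pointProj_mul_diagonalOp (x : X) (f : X → ℂ) (hf : ∀ x, ‖f x‖ ≤ 1) :
    pointProj H x * diagonalOp H f hf = (diagonalOp H f hf * pointProj H x : Op X H) := by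
  ext η z
  simp only [pointProj, mul_apply_eq_comp, diagonalOp_apply]
  exact smul_comm _ _ _

theorem pointProj_mul_permOp (x : X) (σ : X ≃ X) :
    pointProj H x * permOp H σ = (permOp H σ * pointProj H (σ.symm x) : Op X H) := by
  ext η z
  by_cases h : z = x
  · subst h; simp [pointProj]
  · have h' : σ.symm z ≠ σ.symm x := fun h' => h (σ.symm.injective h')
    simp [pointProj, h, h']

/-- `T` is locally compact: all `P_y T P_x` are compact operators. -/
def IsLocallyCompactOp (T : Op X H) : Prop :=
  ∀ x y : X, IsCompactOperator (pointProj H y * T * pointProj H x : Op X H)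

/-- `T` has finite propagation: for some `R > 0`, `P_y T P_x ≠ 0` implies `d(x, y) < R`. -/
def HasFinitePropagation [MetricSpace X] (T : Op X H) : Prop :=
  ∃ R : ℝ, 0 < R ∧ ∀ x y : X, pointProj H y * T * pointProj H x ≠ 0 → dist x y < R

theorem isCompactOperator_mul_left {T : Op X H} (hT : IsCompactOperator T) (S : Op X H) :
    IsCompactOperator (S * T : Op X H) := hT.clm_comp S

theorem isCompactOperator_mul_right {T : Op X H} (hT : IsCompactOperator T) (S : Op X H) :
    IsCompactOperator (T * S : Op X H) := hT.comp_clm S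

/-- The adjoint of a compact operator is compact. -/
theorem isCompactOperator_star {T : Op X H} (hT : IsCompactOperator T) :
    IsCompactOperator (star T : Op X H) := by
  have hc : IsCompactOperator (T * star T : Op X H) := isCompactOperator_mul_right hT _
  have hK := (isCompactOperator_iff_isCompact_closure_image_ball
    ((T * star T : Op X H) : L2 X H →ₗ[ℂ] L2 X H) one_pos).1 hc
  refine (isCompactOperator_iff_isCompact_closure_image_ball
    ((star T : Op X H) : L2 X H →ₗ[ℂ] L2 X H) one_pos).2 ?_
  refine TotallyBounded.isCompact_of_isClosed (TotallyBounded.closure ?_) isClosed_closure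
  have htb := hK.totallyBounded.subset subset_closure
  refine Metric.totallyBounded_iff.2 fun ε hε => ?_
  obtain ⟨t, hts, htf, ht⟩ := Metric.finite_approx_of_totallyBounded htb (ε ^ 2 / 2) (by positivity)
  obtain ⟨u, hu, huf, rfl⟩ := Set.exists_subset_image_finite_and.1 ⟨t, hts, htf, rfl⟩
  refine ⟨(star T : Op X H) '' u, huf.image _, ?_⟩
  rintro _ ⟨v, hv, rfl⟩
  obtain ⟨w, hw, hvw⟩ : ∃ w ∈ u, dist ((T * star T : Op X H) v) ((T * star T : Op X H) w)
      < ε ^ 2 / 2 := by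
    obtain ⟨z, ⟨w, hw, rfl⟩, hz⟩ := Set.mem_iUnion₂.1 (ht ⟨v, hv, rfl⟩)
    exact ⟨w, hw, hz⟩
  refine Set.mem_biUnion ⟨w, hw, rfl⟩ ?_
  change dist (star T v) (star T w) < ε
  rw [dist_eq_norm, ← map_sub]
  rw [dist_eq_norm, ← map_sub] at hvw
  have hw' := hu hw
  rw [mem_ball_zero_iff] at hv hw'
  have hd : ‖v - w‖ ≤ 2 := (norm_sub_le _ _).trans (by linarith)
  refine lt_of_pow_lt_pow_left₀ 2 hε.le ?_
  have h1 : ‖star T (v - w)‖ ^ 2 = RCLike.re (inner ℂ (v - w) ((T * star T : Op X H) (v - w))) := by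
    rw [← inner_self_eq_norm_sq (𝕜 := ℂ)]
    congr 1
    rw [mul_apply_eq_comp, ContinuousLinearMap.star_eq_adjoint,
      ContinuousLinearMap.adjoint_inner_left]
  calc ‖star T (v - w)‖ ^ 2 ≤ ‖v - w‖ * ‖(T * star T : Op X H) (v - w)‖ := by
        rw [h1]; exact re_inner_le_norm _ _
    _ ≤ 2 * ‖(T * star T : Op X H) (v - w)‖ := by gcongr
    _ < 2 * (ε ^ 2 / 2) := by gcongr
    _ = ε ^ 2 := by ring

end Operators

/-! ## Bounded geometry, Roe algebras and Roe coronas -/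

/-- Bounded geometry: for every `R > 0` there is `N` such that all `R`-balls have at most `N`
elements. -/
class BoundedGeometry (X : Type*) [MetricSpace X] : Prop where
  exists_bound : ∀ R : ℝ, 0 < R → ∃ N : ℕ, ∀ x : X, (Metric.ball x R).encard ≤ N

section Roe

variable {X : Type*} [MetricSpace X]
variable {H : Type*} [NormedAddCommGroup H] [InnerProductSpace ℂ H] [CompleteSpace H]

theorem BoundedGeometry.finite_ball [BoundedGeometry X] (x : X) {R : ℝ} (hR : 0 < R) :
    (Metric.ball x R).Finite := by
  obtain ⟨N, hN⟩ := BoundedGeometry.exists_bound (X := X) R hR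
  exact Set.finite_of_encard_le_coe (hN x)

theorem mul_pointProj_eq_sum {T : Op X H} (x : X) (F : Finset X)
    (hF : ∀ z, pointProj H z * T * pointProj H x ≠ 0 → z ∈ F) :
    T * pointProj H x = ∑ z ∈ F, pointProj H z * T * pointProj H x := by
  ext η w
  rw [sum_apply, lp.coeFn_sum, Finset.sum_apply]
  by_cases hw : w ∈ F
  · rw [Finset.sum_eq_single_of_mem w hw]
    · exact (pointProj_apply_self w _).symm
    · intro z _ hz
      exact pointProj_apply_ne hz.symm _
  · rw [Finset.sum_eq_zero]
    · have h : pointProj H w * T * pointProj H x = 0 := by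
        by_contra h; exact hw (hF w h)
      have h2 := congrArg (fun S : Op X H => S η w) h
      exact (pointProj_apply_self w _).symm.trans h2
    · intro z hz
      exact pointProj_apply_ne (fun h => hw (by rw [h]; exact hz)) _

theorem pointProj_mul_mul_pointProj [BoundedGeometry X] (S T : Op X H) {R : ℝ} (hR : 0 < R)
    (x y : X) (hT : ∀ y, pointProj H y * T * pointProj H x ≠ 0 → dist x y < R) :
    pointProj H y * (S * T) * pointProj H x = ∑ z ∈ (BoundedGeometry.finite_ball x hR).toFinset,
      (pointProj H y * S * pointProj H z) * (pointProj H z * T * pointProj H x) := by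
  have h := mul_pointProj_eq_sum (T := T) x (BoundedGeometry.finite_ball x hR).toFinset
    (fun z hz => by simpa [dist_comm] using hT z hz)
  rw [mul_assoc, mul_assoc, h, Finset.mul_sum, Finset.mul_sum]
  refine Finset.sum_congr rfl fun z _ => ?_
  calc _ = pointProj H y * S * pointProj H z * T * pointProj H x := by simp only [mul_assoc]
    _ = pointProj H y * S * (pointProj H z * pointProj H z) * T * pointProj H x := by
      rw [pointProj_mul_self]
    _ = _ := by simp only [mul_assoc]

variable (X H) in
/-- The *-algebra of locally compact operators with finite propagation on `ℓ²(X, H)`. -/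
def algRoeAlgebra [BoundedGeometry X] : NonUnitalStarSubalgebra ℂ (Op X H) where
  carrier := {T | IsLocallyCompactOp T ∧ HasFinitePropagation T}
  zero_mem' := by
    refine ⟨fun x y => ?_, 1, one_pos, fun x y h => ?_⟩
    · rw [mul_zero, zero_mul]; exact isCompactOperator_zero
    · rw [mul_zero, zero_mul] at h; exact absurd rfl h
  add_mem' := by
    rintro S T ⟨hS, RS, hRS, hpS⟩ ⟨hT, RT, hRT, hpT⟩
    refine ⟨fun x y => ?_, max RS RT, lt_max_of_lt_left hRS, fun x y h => ?_⟩
    · rw [mul_add, add_mul]; exact (hS x y).add (hT x y)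
    · rw [mul_add, add_mul] at h
      by_cases h1 : pointProj H y * S * pointProj H x = 0
      · rw [h1, zero_add] at h
        exact lt_max_of_lt_right (hpT x y h)
      · exact lt_max_of_lt_left (hpS x y h1)
  smul_mem' := by
    rintro c T ⟨hT, R, hR, hp⟩
    refine ⟨fun x y => ?_, R, hR, fun x y h => hp x y fun h0 => h ?_⟩
    · rw [mul_smul_comm, smul_mul_assoc]; exact (hT x y).smul c
    · rw [mul_smul_comm, smul_mul_assoc, h0, smul_zero]
  mul_mem' := by
    rintro S T ⟨hS, RS, hRS, hpS⟩ ⟨hT, RT, hRT, hpT⟩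
    refine ⟨fun x y => ?_, RS + RT, add_pos hRS hRT, fun x y h => ?_⟩
    · rw [pointProj_mul_mul_pointProj S T hRT x y (hpT x)]
      exact Submodule.sum_mem (compactOperator (RingHom.id ℂ) (L2 X H) (L2 X H))
        fun z _ => isCompactOperator_mul_left (hT x z) _
    · rw [pointProj_mul_mul_pointProj S T hRT x y (hpT x)] at h
      obtain ⟨z, -, hz⟩ := Finset.exists_ne_zero_of_sum_ne_zero h
      have h1 := hpS z y (left_ne_zero_of_mul hz)
      have h2 := hpT x z (right_ne_zero_of_mul hz)
      linarith [dist_triangle x z y]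
  star_mem' := by
    rintro T ⟨hT, R, hR, hp⟩
    have hs : ∀ x y : X, pointProj H y * star T * pointProj H x =
        star (pointProj H x * T * pointProj H y) := fun x y => by
      rw [star_mul, star_mul, star_pointProj, star_pointProj, mul_assoc]
    refine ⟨fun x y => ?_, R, hR, fun x y h => ?_⟩
    · rw [hs]; exact isCompactOperator_star (hT y x)
    · rw [hs, star_ne_zero] at h
      rw [dist_comm]; exact hp y x h

variable (X H) in
/-- The Roe algebra: the norm closure of the locally compact operators with finite propagation on
`ℓ²(X, H)`. For `H` separable and infinite-dimensional this is `C*(X)`. -/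
def RoeAlgebra [BoundedGeometry X] : NonUnitalStarSubalgebra ℂ (Op X H) :=
  (algRoeAlgebra X H).topologicalClosure

instance [BoundedGeometry X] : IsClosed (RoeAlgebra X H : Set (Op X H)) :=
  NonUnitalStarSubalgebra.isClosed_topologicalClosure _

instance [BoundedGeometry X] : NonUnitalCStarAlgebra (RoeAlgebra X H) :=
  NonUnitalStarSubalgebra.nonUnitalCStarAlgebra _

variable (X) in
/-- The uniform Roe algebra `C*_u(X)`: the case `H = ℂ`, in which local compactness is automatic. -/
abbrev UniformRoeAlgebra [BoundedGeometry X] : NonUnitalStarSubalgebra ℂ (Op X ℂ) := RoeAlgebra X ℂ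

open scoped Classical in
theorem isLocallyCompactOp_complex (T : Op X ℂ) : IsLocallyCompactOp T := by
  intro x y
  have h : (pointProj ℂ x : Op X ℂ) = lp.singleContinuousLinearMap ℂ (fun _ : X => ℂ) 2 x ∘L
      lp.evalCLM ℂ (fun _ : X => ℂ) 2 x := by
    ext η z
    by_cases hz : z = x
    · subst hz
      rw [pointProj_apply_self]
      exact (lp.single_apply_self (E := fun _ : X => ℂ) 2 z (η z)).symm
    · rw [pointProj_apply_ne hz]
      exact (lp.single_apply_ne (E := fun _ : X => ℂ) 2 x (η x) hz).symm
  rw [h]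
  exact (isCompactOperator_of_locallyCompactSpace_dom
    (lp.evalCLM ℂ (fun _ : X => ℂ) 2 x)).clm_comp
      ((pointProj ℂ y * T) ∘L lp.singleContinuousLinearMap ℂ (fun _ : X => ℂ) 2 x)

/-- `C*_u(X)` is the norm closure of the operators with finite propagation on `ℓ²(X)`. -/
theorem coe_uniformRoeAlgebra [BoundedGeometry X] :
    (UniformRoeAlgebra X : Set (Op X ℂ)) = closure {T | HasFinitePropagation T} := by
  change closure {T : Op X ℂ | IsLocallyCompactOp T ∧ HasFinitePropagation T} = _
  simp only [isLocallyCompactOp_complex, true_and]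

variable (X H) in
/-- The ideal of compact operators on `ℓ²(X, H)` that lie in the Roe algebra (all of them do). -/
def compactIdeal [BoundedGeometry X] : ClosedIdeal (RoeAlgebra X H) where
  carrier := {a | IsCompactOperator (a : Op X H)}
  zero_mem' := isCompactOperator_zero
  add_mem' := fun ha hb => ha.add hb
  smul_mem' := fun c _ ha => ha.smul c
  mul_mem_left' := fun _ _ hx => isCompactOperator_mul_left hx _
  mul_mem_right' := fun _ _ hx => isCompactOperator_mul_right hx _
  star_mem' := fun hx => isCompactOperator_star hx
  isClosed' := isClosed_setOfPred_isCompactOperator.preimage continuous_subtype_val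

theorem mem_compactIdeal [BoundedGeometry X] {a : RoeAlgebra X H} :
    a ∈ (compactIdeal X H).toSubmodule ↔ IsCompactOperator (a : Op X H) := Iff.rfl

variable (X H) in
/-- The Roe corona `C*(X) / 𝒦`. -/
abbrev RoeCorona [BoundedGeometry X] : Type _ := (compactIdeal X H).Quotient

variable (X) in
/-- The uniform Roe corona `C*_u(X) / 𝒦`. -/
abbrev UniformRoeCorona [BoundedGeometry X] : Type _ := RoeCorona X ℂ

/-! ### Permutation automorphisms and diagonal multipliers -/

theorem permOp_conj_mem [BoundedGeometry X] (σ : X ≃ᵢ X) {T : Op X H} (hT : T ∈ RoeAlgebra X H) :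
    permOp H σ.toEquiv * T * star (permOp H σ.toEquiv) ∈ RoeAlgebra X H := by
  refine map_mem_closure (f := fun T : Op X H => permOp H σ.toEquiv * T * star (permOp H σ.toEquiv))
    (by fun_prop) hT ?_
  rintro T ⟨hT, R, hR, hp⟩
  have hs : ∀ x y : X, pointProj H y * (permOp H σ.toEquiv * T * star (permOp H σ.toEquiv)) * pointProj H x
      = permOp H σ.toEquiv * (pointProj H (σ.symm y) * T * pointProj H (σ.symm x)) *
        star (permOp H σ.toEquiv) := fun x y => by
    have h1 := pointProj_mul_permOp (H := H) y σ.toEquiv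
    have h2 := congrArg star (pointProj_mul_permOp (H := H) x σ.toEquiv)
    rw [star_mul, star_mul, star_pointProj, star_pointProj] at h2
    calc _ = (pointProj H y * permOp H σ.toEquiv) * T * (star (permOp H σ.toEquiv) * pointProj H x) := by
          simp only [mul_assoc]
      _ = _ := by
          rw [h1, h2]
          simp only [mul_assoc]
          rfl
  refine ⟨fun x y => ?_, R, hR, fun x y h => ?_⟩
  · rw [hs]
    exact isCompactOperator_mul_right (isCompactOperator_mul_left (hT _ _) _) _
  · rw [hs] at h
    have := hp _ _ (right_ne_zero_of_mul (left_ne_zero_of_mul h))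
    rwa [σ.symm.dist_eq] at this

/-- The automorphism `a ↦ U a U*` of the Roe algebra, where `U` is the permutation unitary of a
bijective isometry of `X`. -/
def roeConj [BoundedGeometry X] (σ : X ≃ᵢ X) : RoeAlgebra X H ≃⋆ₐ[ℂ] RoeAlgebra X H where
  toFun a := ⟨permOp H σ.toEquiv * a * star (permOp H σ.toEquiv), permOp_conj_mem σ a.2⟩
  invFun a := ⟨permOp H σ.symm.toEquiv * a * star (permOp H σ.symm.toEquiv), permOp_conj_mem σ.symm a.2⟩
  left_inv a := by
    refine Subtype.ext ?_
    change permOp H σ.toEquiv.symm * (permOp H σ.toEquiv * (a : Op X H) * star (permOp H σ.toEquiv)) *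
      star (permOp H σ.toEquiv.symm) = a
    rw [star_permOp, star_permOp, Equiv.symm_symm]
    calc _ = (permOp H σ.toEquiv.symm * permOp H σ.toEquiv) * (a : Op X H) *
          (permOp H σ.toEquiv.symm * permOp H σ.toEquiv) := by simp only [mul_assoc]
      _ = _ := by rw [permOp_symm_mul, one_mul, mul_one]
  right_inv a := by
    refine Subtype.ext ?_
    change permOp H σ.toEquiv * (permOp H σ.toEquiv.symm * (a : Op X H) *
      star (permOp H σ.toEquiv.symm)) * star (permOp H σ.toEquiv) = a
    rw [star_permOp, star_permOp, Equiv.symm_symm]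
    calc _ = (permOp H σ.toEquiv * permOp H σ.toEquiv.symm) * (a : Op X H) *
          (permOp H σ.toEquiv * permOp H σ.toEquiv.symm) := by simp only [mul_assoc]
      _ = _ := by rw [permOp_mul_symm, one_mul, mul_one]
  map_mul' a b := by
    refine Subtype.ext ?_
    change permOp H σ.toEquiv * ((a : Op X H) * b) * star (permOp H σ.toEquiv) =
      (permOp H σ.toEquiv * a * star (permOp H σ.toEquiv)) *
      (permOp H σ.toEquiv * b * star (permOp H σ.toEquiv))
    rw [star_permOp]
    calc _ = permOp H σ.toEquiv * (a : Op X H) * 1 * b * permOp H σ.toEquiv.symm := by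
          simp only [mul_assoc, one_mul]
      _ = _ := by rw [← permOp_symm_mul σ.toEquiv]; simp only [mul_assoc]
  map_add' a b := by
    refine Subtype.ext ?_
    change permOp H σ.toEquiv * ((a : Op X H) + b) * star (permOp H σ.toEquiv) = _ + _
    rw [mul_add, add_mul]
  map_star' a := by
    refine Subtype.ext ?_
    change permOp H σ.toEquiv * star (a : Op X H) * star (permOp H σ.toEquiv) =
      star (permOp H σ.toEquiv * (a : Op X H) * star (permOp H σ.toEquiv))
    rw [star_mul, star_mul, star_star, mul_assoc]
  map_smul' c a := by
    refine Subtype.ext ?_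
    change permOp H σ.toEquiv * (c • (a : Op X H)) * star (permOp H σ.toEquiv) = c • _
    rw [mul_smul_comm, smul_mul_assoc]

theorem coe_roeConj [BoundedGeometry X] (σ : X ≃ᵢ X) (a : RoeAlgebra X H) :
    (roeConj σ a : Op X H) = permOp H σ.toEquiv * a * star (permOp H σ.toEquiv) := rfl

theorem roeConj_mem_compactIdeal [BoundedGeometry X] (σ : X ≃ᵢ X) (a : RoeAlgebra X H) :
    roeConj σ a ∈ (compactIdeal X H).toSubmodule ↔ a ∈ (compactIdeal X H).toSubmodule := by
  have key : ∀ (τ : X ≃ᵢ X) (b : RoeAlgebra X H), b ∈ (compactIdeal X H).toSubmodule →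
      roeConj τ b ∈ (compactIdeal X H).toSubmodule := fun τ b hb => by
    rw [mem_compactIdeal] at hb ⊢
    exact isCompactOperator_mul_right (isCompactOperator_mul_left hb _) _
  refine ⟨fun h => ?_, key σ a⟩
  have := key σ.symm _ h
  rwa [show roeConj σ.symm (roeConj σ a) = a from (roeConj σ).symm_apply_apply a] at this

/-- The automorphism `[a] ↦ [U a U*]` of the Roe corona. -/
def coronaConj [BoundedGeometry X] (σ : X ≃ᵢ X) : RoeCorona X H ≃⋆ₐ[ℂ] RoeCorona X H :=
  ClosedIdeal.mapEquiv (roeConj σ) (roeConj_mem_compactIdeal σ)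

theorem diagonalOp_mul_mem [BoundedGeometry X] (f : X → ℂ) (hf : ∀ x, ‖f x‖ ≤ 1) {T : Op X H}
    (hT : T ∈ RoeAlgebra X H) : diagonalOp H f hf * T ∈ RoeAlgebra X H := by
  refine map_mem_closure (f := fun T : Op X H => diagonalOp H f hf * T) (by fun_prop) hT ?_
  rintro T ⟨hT, R, hR, hp⟩
  have hs : ∀ x y : X, pointProj H y * (diagonalOp H f hf * T) * pointProj H x =
      diagonalOp H f hf * (pointProj H y * T * pointProj H x) := fun x y => by
    simp only [← mul_assoc, pointProj_mul_diagonalOp]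
  refine ⟨fun x y => ?_, R, hR, fun x y h => ?_⟩
  · rw [hs]; exact isCompactOperator_mul_left (hT _ _) _
  · rw [hs] at h; exact hp x y (right_ne_zero_of_mul h)

theorem mul_diagonalOp_mem [BoundedGeometry X] (f : X → ℂ) (hf : ∀ x, ‖f x‖ ≤ 1) {T : Op X H}
    (hT : T ∈ RoeAlgebra X H) : T * diagonalOp H f hf ∈ RoeAlgebra X H := by
  refine map_mem_closure (f := fun T : Op X H => T * diagonalOp H f hf) (by fun_prop) hT ?_
  rintro T ⟨hT, R, hR, hp⟩
  have hs : ∀ x y : X, pointProj H y * (T * diagonalOp H f hf) * pointProj H x =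
      (pointProj H y * T * pointProj H x) * diagonalOp H f hf := fun x y => by
    simp only [mul_assoc, pointProj_mul_diagonalOp]
  refine ⟨fun x y => ?_, R, hR, fun x y h => ?_⟩
  · rw [hs]; exact isCompactOperator_mul_right (hT _ _) _
  · rw [hs] at h; exact hp x y (left_ne_zero_of_mul h)

/-- The diagonal operator `D` as a multiplier of the Roe algebra: `a ↦ D a` and `a ↦ a D`. -/
def roeDiagonal [BoundedGeometry X] (f : X → ℂ) (hf : ∀ x, ‖f x‖ ≤ 1) :
    𝓜(ℂ, RoeAlgebra X H) where
  fst := LinearMap.mkContinuous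
    { toFun := fun a => ⟨diagonalOp H f hf * a, diagonalOp_mul_mem f hf a.2⟩
      map_add' := fun _ _ => Subtype.ext (mul_add _ _ _)
      map_smul' := fun _ _ => Subtype.ext (mul_smul_comm _ _ _) } ‖(diagonalOp H f hf : Op X H)‖
    (fun a => norm_mul_le (diagonalOp H f hf) (a : Op X H))
  snd := LinearMap.mkContinuous
    { toFun := fun a => ⟨a * diagonalOp H f hf, mul_diagonalOp_mem f hf a.2⟩
      map_add' := fun _ _ => Subtype.ext (add_mul _ _ _)
      map_smul' := fun _ _ => Subtype.ext (smul_mul_assoc _ _ _) } ‖(diagonalOp H f hf : Op X H)‖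
    (fun a => (norm_mul_le (a : Op X H) (diagonalOp H f hf)).trans_eq (mul_comm _ _))
  central _ _ := Subtype.ext (mul_assoc _ _ _)

/-- The class of the diagonal operator `D` modulo the compacts, as a multiplier of the Roe corona:
`[a] ↦ [D a]` and `[a] ↦ [a D]`. -/
def coronaDiagonal [BoundedGeometry X] (f : X → ℂ) (hf : ∀ x, ‖f x‖ ≤ 1) :
    𝓜(ℂ, RoeCorona X H) :=
  ClosedIdeal.mapMultiplier (roeDiagonal f hf)
    (fun _ ha => isCompactOperator_mul_left (mem_compactIdeal.1 ha) _)
    (fun _ ha => isCompactOperator_mul_right (mem_compactIdeal.1 ha) _)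

theorem coronaConj_mk [BoundedGeometry X] (σ : X ≃ᵢ X) (a : RoeAlgebra X H) :
    coronaConj σ ((compactIdeal X H).mk a) = (compactIdeal X H).mk (roeConj σ a) := rfl

theorem coronaDiagonal_fst_mk [BoundedGeometry X] (f : X → ℂ) (hf : ∀ x, ‖f x‖ ≤ 1)
    (a : RoeAlgebra X H) : (coronaDiagonal f hf).fst ((compactIdeal X H).mk a) =
      (compactIdeal X H).mk ⟨diagonalOp H f hf * a, diagonalOp_mul_mem f hf a.2⟩ := rfl

theorem coronaDiagonal_snd_mk [BoundedGeometry X] (f : X → ℂ) (hf : ∀ x, ‖f x‖ ≤ 1)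
    (a : RoeAlgebra X H) : (coronaDiagonal f hf).snd ((compactIdeal X H).mk a) =
      (compactIdeal X H).mk ⟨a * diagonalOp H f hf, mul_diagonalOp_mem f hf a.2⟩ := rfl

end Roe


/-! ## The wedge of `|G|` copies of a pointed metric space -/

/-- The wedge of copies `Y_g` (`g ∈ G`) of `Y`, glued along the point `y₀`: its points are the
common base point, and the points `y ≠ y₀` of each copy `Y_g`. -/
inductive Wedge (G : Type*) {Y : Type*} (y₀ : Y) : Type _
  | base : Wedge G y₀
  | pt (g : G) (y : Y) (hy : y ≠ y₀) : Wedge G y₀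

namespace Wedge

variable {G : Type*} {Y : Type*} [MetricSpace Y] {y₀ : Y}

open scoped Classical in
/-- The wedge metric: the metric `d` of `Y` on each copy, and `d(x, y₀) + d(y₀, y)` for `x`, `y` in
distinct copies. -/
instance : Dist (Wedge G y₀) where
  dist
    | base, base => 0
    | base, pt _ y _ => dist y₀ y
    | pt _ x _, base => dist x y₀
    | pt g x _, pt h y _ => if g = h then dist x y else dist x y₀ + dist y₀ y

theorem dist_base_base : dist (base : Wedge G y₀) base = 0 := rfl

theorem dist_base_pt (g : G) (y : Y) (hy : y ≠ y₀) : dist base (pt g y hy) = dist y₀ y := rfl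

theorem dist_pt_base (g : G) (y : Y) (hy : y ≠ y₀) : dist (pt g y hy) base = dist y y₀ := rfl

theorem dist_pt_same (g : G) (x y : Y) (hx : x ≠ y₀) (hy : y ≠ y₀) :
    dist (pt g x hx) (pt g y hy) = dist x y := if_pos rfl

theorem dist_pt_ne {g h : G} (hgh : g ≠ h) (x y : Y) (hx : x ≠ y₀) (hy : y ≠ y₀) :
    dist (pt g x hx) (pt h y hy) = dist x y₀ + dist y₀ y := if_neg hgh

instance : MetricSpace (Wedge G y₀) where
  dist_self
    | base => rfl
    | pt g x hx => by rw [dist_pt_same, dist_self]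
  dist_comm
    | base, base => rfl
    | base, pt g y _ => dist_comm y₀ y
    | pt g x _, base => dist_comm x y₀
    | pt g x hx, pt h y hy => by
      by_cases hgh : g = h
      · subst hgh
        rw [dist_pt_same, dist_pt_same, dist_comm]
      · rw [dist_pt_ne hgh, dist_pt_ne (Ne.symm hgh), dist_comm x, dist_comm y₀ y, add_comm]
  dist_triangle
    | base, base, base => by simp [dist_base_base]
    | base, base, pt k z hz => by simp [dist_base_base]
    | base, pt h y hy, base => by
      rw [dist_base_base, dist_base_pt, dist_pt_base]; positivity
    | base, pt h y hy, pt k z hz => by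
      by_cases hhk : h = k
      · subst hhk
        rw [dist_pt_same, dist_base_pt, dist_base_pt]; exact dist_triangle _ _ _
      · rw [dist_pt_ne hhk, dist_base_pt, dist_base_pt]
        linarith [dist_nonneg (x := y₀) (y := y), dist_nonneg (x := y) (y := y₀)]
    | pt g x hx, base, base => by simp [dist_base_base]
    | pt g x hx, base, pt k z hz => by
      rw [dist_base_pt, dist_pt_base]
      by_cases hgk : g = k
      · subst hgk
        rw [dist_pt_same]; exact dist_triangle _ _ _
      · rw [dist_pt_ne hgk]
    | pt g x hx, pt h y hy, base => by
      by_cases hgh : g = h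
      · subst hgh
        rw [dist_pt_same, dist_pt_base, dist_pt_base]; exact dist_triangle _ _ _
      · rw [dist_pt_ne hgh, dist_pt_base, dist_pt_base]
        linarith [dist_nonneg (x := y₀) (y := y), dist_nonneg (x := y) (y := y₀)]
    | pt g x hx, pt h y hy, pt k z hz => by
      have h0 := dist_nonneg (x := y) (y := y₀)
      have h1 := dist_comm y y₀
      have h2 := dist_triangle x y y₀
      have h3 := dist_triangle y₀ y z
      have h4 := dist_triangle x y₀ z
      have h5 := dist_triangle x y z
      by_cases hgh : g = h
      · subst hgh
        rw [dist_pt_same]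
        by_cases hgk : g = k
        · subst hgk
          rw [dist_pt_same, dist_pt_same]; exact h5
        · rw [dist_pt_ne hgk, dist_pt_ne hgk]; linarith
      · rw [dist_pt_ne hgh]
        by_cases hhk : h = k
        · subst hhk
          rw [dist_pt_ne hgh, dist_pt_same]; linarith
        · rw [dist_pt_ne hhk]
          by_cases hgk : g = k
          · subst hgk
            rw [dist_pt_same]; linarith
          · rw [dist_pt_ne hgk]; linarith
  eq_of_dist_eq_zero {a b} hab := by
    match a, b, hab with
    | base, base, _ => rfl
    | base, pt h y hy, hab => exact absurd (dist_eq_zero.1 hab).symm hy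
    | pt g x hx, base, hab => exact absurd (dist_eq_zero.1 hab) hx
    | pt g x hx, pt h y hy, hab =>
      by_cases hgh : g = h
      · subst hgh
        rw [dist_pt_same] at hab
        cases dist_eq_zero.1 hab
        rfl
      · rw [dist_pt_ne hgh] at hab
        have h1 : 0 < dist x y₀ := dist_pos.2 hx
        have h2 := dist_nonneg (x := y₀) (y := y)
        linarith

open scoped Classical in
/-- The inclusion of `Y` as the copy `Y_g`. -/
def incl (g : G) (y : Y) : Wedge G y₀ := if hy : y = y₀ then base else pt g y hy

theorem incl_base (g : G) : (incl g y₀ : Wedge G y₀) = base := dif_pos rfl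

theorem incl_of_ne (g : G) {y : Y} (hy : y ≠ y₀) : (incl g y : Wedge G y₀) = pt g y hy := dif_neg hy

theorem isometry_incl (g : G) : Isometry (incl g : Y → Wedge G y₀) := by
  refine Isometry.of_dist_eq fun x y => ?_
  by_cases hx : x = y₀ <;> by_cases hy : y = y₀
  · subst hx; subst hy; rw [incl_base, dist_base_base, dist_self]
  · subst hx; rw [incl_base, incl_of_ne _ hy, dist_base_pt]
  · subst hy; rw [incl_base, incl_of_ne _ hx, dist_pt_base]
  · rw [incl_of_ne _ hx, incl_of_ne _ hy, dist_pt_same]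

theorem dist_incl_of_ne {g h : G} (hgh : g ≠ h) (x y : Y) :
    dist (incl g x : Wedge G y₀) (incl h y) = dist x y₀ + dist y₀ y := by
  by_cases hx : x = y₀ <;> by_cases hy : y = y₀
  · subst hx; subst hy; rw [incl_base, incl_base, dist_base_base, dist_self, add_zero]
  · subst hx; rw [incl_base, incl_of_ne _ hy, dist_base_pt, dist_self, zero_add]
  · subst hy; rw [incl_base, incl_of_ne _ hx, dist_pt_base, dist_self, add_zero]
  · rw [incl_of_ne _ hx, incl_of_ne _ hy, dist_pt_ne hgh]

instance [Finite G] [BoundedGeometry Y] : BoundedGeometry (Wedge G y₀) where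
  exists_bound R hR := by
    have := Fintype.ofFinite G
    obtain ⟨N, hN⟩ := BoundedGeometry.exists_bound (X := Y) R hR
    have key : ∀ (x : Wedge G y₀) (y : Y), (∀ (h : G) (z : Y) (hz : z ≠ y₀),
        dist (pt h z hz) x < R → dist z y < R ∨ dist z y₀ < R) →
        (Metric.ball x R).encard ≤ ((1 + Fintype.card G * (N + N) : ℕ) : ℕ∞) := by
      intro x y hxy
      have hsub : Metric.ball x R ⊆ {base} ∪ ⋃ h ∈ (Finset.univ : Finset G),
          (incl h '' (Metric.ball y R ∪ Metric.ball y₀ R) : Set (Wedge G y₀)) := by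
        intro p hp
        match p, hp with
        | base, _ => exact Or.inl rfl
        | pt h z hz, hp =>
          refine Or.inr (Set.mem_biUnion (Finset.mem_univ h) ⟨z, ?_, incl_of_ne h hz⟩)
          exact hxy h z hz hp
      refine (Set.encard_le_encard hsub).trans ((Set.encard_union_le _ _).trans ?_)
      rw [Set.encard_singleton]
      push_cast
      gcongr
      refine (Finset.set_encard_biUnion_le _ _).trans ?_
      refine (Finset.sum_le_card_nsmul _ _ ((N : ℕ∞) + N) fun h _ => ?_).trans ?_
      · exact (Set.encard_image_le _ _).trans
          ((Set.encard_union_le _ _).trans (add_le_add (hN _) (hN _)))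
      · rw [nsmul_eq_mul, Finset.card_univ]
    refine ⟨1 + Fintype.card G * (N + N), fun x => ?_⟩
    match x with
    | base => exact key base y₀ fun h z hz hd => Or.inr hd
    | pt g x hx =>
      refine key (pt g x hx) x fun h z hz hd => ?_
      by_cases hhg : h = g
      · subst hhg
        rw [dist_pt_same] at hd; exact Or.inl hd
      · rw [dist_pt_ne hhg] at hd
        exact Or.inr (by linarith [dist_nonneg (x := y₀) (y := x)])

variable [Group G]

/-- `G` permutes the copies: `g · y_h = y_{gh}`, fixing the base point. -/
instance : MulAction G (Wedge G y₀) where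
  smul g
    | base => base
    | pt h y hy => pt (g * h) y hy
  one_smul
    | base => rfl
    | pt h y hy => congrArg (fun k => pt k y hy) (one_mul h)
  mul_smul g h
    | base => rfl
    | pt k y hy => congrArg (fun l => pt l y hy) (mul_assoc g h k)

theorem smul_base (g : G) : g • (base : Wedge G y₀) = base := rfl

theorem smul_pt (g h : G) (y : Y) (hy : y ≠ y₀) : g • pt h y hy = pt (g * h) y hy := rfl

instance : IsIsometricSMul G (Wedge G y₀) where
  isometry_smul g := by
    refine Isometry.of_dist_eq fun a b => ?_
    match a, b with
    | base, base => rfl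
    | base, pt h y hy => rfl
    | pt h x hx, base => rfl
    | pt h x hx, pt k y hy =>
      rw [smul_pt, smul_pt]
      by_cases hhk : h = k
      · subst hhk
        rw [dist_pt_same, dist_pt_same]
      · rw [dist_pt_ne hhk, dist_pt_ne fun h' => hhk (mul_left_cancel h')]

/-- The phase `ω(g, h, h⁻¹ g⁻¹ k)⁻¹` on `Y_k - {y₀}`, and `1` at the base point. -/
def phase (ω : G → G → G → Circle) (g h : G) : Wedge G y₀ → ℂ
  | base => 1
  | pt k _ _ => ((ω g h (h⁻¹ * g⁻¹ * k))⁻¹ : Circle)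

theorem norm_phase_le (ω : G → G → G → Circle) (g h : G) (x : Wedge G y₀) :
    ‖phase ω g h x‖ ≤ 1 := by
  match x with
  | base => simp [phase]
  | pt k y hy => exact (Circle.norm_coe _).le

variable (y₀) (H : Type*) [NormedAddCommGroup H] [InnerProductSpace ℂ H] [CompleteSpace H]
  [Finite G] [BoundedGeometry Y]

/-- The automorphism `α_g : [a] ↦ [U_g a U_g*]` of the Roe corona of the wedge, where
`(U_g η)(x) = η(g⁻¹ x)`. -/
def alpha (g : G) : RoeCorona (Wedge G y₀) H ≃⋆ₐ[ℂ] RoeCorona (Wedge G y₀) H :=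
  coronaConj (IsometryEquiv.constSMul g)

/-- The class `[m_{g,h}]` modulo the compacts of the diagonal unitary `m_{g,h}` with entries
`phase ω g h`, as a multiplier of the Roe corona of the wedge. -/
def mult (ω : G → G → G → Circle) (g h : G) : 𝓜(ℂ, RoeCorona (Wedge G y₀) H) :=
  coronaDiagonal (phase ω g h) (norm_phase_le ω g h)

end Wedge

end Coarse

end

/-! The permutation unitaries satisfy `U_g U_h = U_{gh}` on the nose, so `α_g α_h = α_{gh}`, and the
intertwining relation says exactly that each `[m_{g,h}]` commutes with the corona. The diagonal
function of `m_{g,h}` is constant on every branch of the wedge. An operator of propagation less than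
`R` can join points with different entries only inside the `R`-ball about the base point, because a
path between two branches is at least as long as the detour through that point. This ball is finite
by bounded geometry, so the commutator has finitely many nonzero matrix entries; these are compact
by local compactness, hence so is the commutator. Norm limits extend this to the whole Roe algebra
(`isCompactOperator_commutator_diagonalOp`, `coronaDiagonal_mul_coe_comm`).

Both sides of the anomaly relation are diagonal, since conjugation by `U_g` translates the diagonal
function by `g⁻¹`. On a branch `Y_l` the two functions agree by the cocycle identity
(`phase_anomaly`). At the base point all phases are 1 and the two sides differ by the factor
`ω(g,h,k)`. This defect is a multiple of the projection `P` onto functions supported there. Even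
when `P` is not compact, its product with any element of the Roe algebra is, so the defect is zero
as a multiplier of the corona (`coronaDiagonal_congr_of_ne`). This is where an honest cocycle on
operators becomes an anomaly on the quotient.

The argument works for every Hilbert space `H`, so it covers the Roe corona and, with `H = ℂ`, the
uniform one. -/

namespace Coarse

open scoped MultiplierAlgebra

set_option linter.unusedSectionVars false

/-! ### Identities for point projections, diagonal operators and permutation unitaries. -/

section Operators

variable {X : Type*} {H : Type*} [NormedAddCommGroup H] [InnerProductSpace ℂ H] [CompleteSpace H]

open scoped Classical in
theorem pointProj_eq_single (x : X) (η : L2 X H) :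
    pointProj H x η = lp.single 2 x (η x) := by
  ext z
  by_cases hz : z = x
  · subst hz
    rw [pointProj_apply_self]
    exact (lp.single_apply_self (E := fun _ : X => H) 2 z (η z)).symm
  · rw [pointProj_apply_ne hz]
    exact (lp.single_apply_ne (E := fun _ : X => H) 2 x (η x) hz).symm

theorem hasSum_pointProj (η : L2 X H) : HasSum (fun x => pointProj H x η) η := by
  classical
  simp only [pointProj_eq_single]
  exact lp.hasSum_single (by norm_num) η

/-- The point projections sum to the identity only strongly, so the decomposition of `T` into
columns is checked vector by vector; finitely many nonzero columns make it an identity of operators.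
-/
theorem eq_sum_mul_pointProj {T : Op X H} (F : Finset X)
    (hF : ∀ x, x ∉ F → T * pointProj H x = 0) : T = ∑ x ∈ F, T * pointProj H x := by
  ext1 η
  have h1 : HasSum (fun x => T (pointProj H x η)) (T η) := (hasSum_pointProj η).mapL T
  have h2 : HasSum (fun x => T (pointProj H x η)) (∑ x ∈ F, T (pointProj H x η)) :=
    hasSum_sum_of_ne_finset_zero fun x hx => congrArg (fun S : Op X H => S η) (hF x hx)
  rw [h1.unique h2, sum_apply]
  rfl

theorem isCompactOperator_sum {ι : Type*} (F : Finset ι) {T : ι → Op X H}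
    (hT : ∀ i ∈ F, IsCompactOperator (T i)) : IsCompactOperator (∑ i ∈ F, T i : Op X H) :=
  Submodule.sum_mem (compactOperator (RingHom.id ℂ) (L2 X H) (L2 X H)) hT

theorem pointProj_mul_diagonalOp_eq_smul (x : X) (f : X → ℂ) (hf : ∀ x, ‖f x‖ ≤ 1) :
    pointProj H x * diagonalOp H f hf = (f x • pointProj H x : Op X H) := by
  ext η z
  by_cases h : z = x
  · subst h; simp [pointProj]
  · simp [pointProj, h]

theorem diagonalOp_mul_diagonalOp (f f' : X → ℂ) (hf : ∀ x, ‖f x‖ ≤ 1) (hf' : ∀ x, ‖f' x‖ ≤ 1) :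
    diagonalOp H f hf * diagonalOp H f' hf' = (diagonalOp H (fun x => f x * f' x)
      (fun x => by rw [norm_mul]; exact mul_le_one₀ (hf x) (norm_nonneg _) (hf' x)) : Op X H) := by
  ext η z
  exact smul_smul _ _ _

theorem permOp_mul_permOp (σ τ : X ≃ X) :
    permOp H σ * permOp H τ = (permOp H (τ.trans σ) : Op X H) := rfl

/-- Moving the permutation past the diagonal operator translates the function by `σ⁻¹`; this later
gives the action of `α_g` on the phases. -/
theorem permOp_mul_diagonalOp (σ : X ≃ X) (f : X → ℂ) (hf : ∀ x, ‖f x‖ ≤ 1) :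
    permOp H σ * diagonalOp H f hf =
      (diagonalOp H (fun x => f (σ.symm x)) (fun _ => hf _) * permOp H σ : Op X H) := rfl

theorem diagonalOp_sub_eq_smul_pointProj {f f' : X → ℂ} (hf : ∀ x, ‖f x‖ ≤ 1)
    (hf' : ∀ x, ‖f' x‖ ≤ 1) (x₀ : X) (h : ∀ x, x ≠ x₀ → f x = f' x) :
    diagonalOp H f hf - diagonalOp H f' hf' = ((f x₀ - f' x₀) • pointProj H x₀ : Op X H) := by
  ext η z
  change f z • η z - f' z • η z = (f x₀ - f' x₀) • pointProj H x₀ η z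
  by_cases hz : z = x₀
  · subst hz
    rw [pointProj_apply_self, sub_smul]
  · rw [pointProj_apply_ne hz, h z hz, sub_self, smul_zero]

end Operators

/-! ### Compactness criteria for operators built from the Roe algebra. -/

section Roe

variable {X : Type*} [MetricSpace X] [BoundedGeometry X]
variable {H : Type*} [NormedAddCommGroup H] [InnerProductSpace ℂ H] [CompleteSpace H]

theorem mul_pointProj_eq_zero {T : Op X H} {x : X}
    (h : ∀ y, pointProj H y * T * pointProj H x = 0) : T * pointProj H x = 0 := by
  classical
  rw [mul_pointProj_eq_sum x ∅ fun z hz => absurd (h z) hz, Finset.sum_empty]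

/-- A locally compact operator with finitely many nonzero matrix entries is compact. -/
theorem IsLocallyCompactOp.isCompactOperator_of_finite {T : Op X H} (hT : IsLocallyCompactOp T)
    (F : Finset X) (hF : ∀ x y, pointProj H y * T * pointProj H x ≠ 0 → x ∈ F ∧ y ∈ F) :
    IsCompactOperator T := by
  -- A column outside `F` vanishes because all of its entries do. The remaining columns are then cut
  -- into their entries, which leaves a finite double sum of compact operators.
  rw [eq_sum_mul_pointProj (T := T) F fun x hx => mul_pointProj_eq_zero fun y => by
    by_contra h
    exact hx (hF x y h).1]
  refine isCompactOperator_sum F fun x _ => ?_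
  rw [mul_pointProj_eq_sum x F fun z hz => (hF x z hz).2]
  exact isCompactOperator_sum F fun z _ => hT x z

/-- The commutators of a contractive diagonal operator with the Roe algebra are compact as soon as,
for every `R`, the diagonal entries at points of distance less than `R` differ only within a bounded
set. -/
theorem isCompactOperator_commutator_diagonalOp (f : X → ℂ) (hf : ∀ x, ‖f x‖ ≤ 1)
    (hbd : ∀ R : ℝ, 0 < R → ∃ F : Finset X, ∀ x y, dist x y < R → f x ≠ f y → x ∈ F ∧ y ∈ F)
    {T : Op X H} (hT : T ∈ RoeAlgebra X H) :
    IsCompactOperator (diagonalOp H f hf * T - T * diagonalOp H f hf : Op X H) := by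
  -- The commutator depends continuously on `T` and the compact operators are norm closed, so `T`
  -- may be taken locally compact of finite propagation.
  refine closure_minimal (s := (algRoeAlgebra X H : Set (Op X H)))
    (t := {T | IsCompactOperator (diagonalOp H f hf * T - T * diagonalOp H f hf : Op X H)})
    ?_ (isClosed_setOfPred_isCompactOperator.preimage
      (f := fun T : Op X H => diagonalOp H f hf * T - T * diagonalOp H f hf) (by fun_prop)) hT
  rintro T ⟨hT, R, hR, hp⟩
  -- Commuting with a diagonal operator multiplies the entry from `x` to `y` by `f y - f x`, so an
  -- entry survives only where `f` changes within the propagation of `T`.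
  have hs : ∀ x y : X, pointProj H y * (diagonalOp H f hf * T - T * diagonalOp H f hf) *
      pointProj H x = (f y - f x) • (pointProj H y * T * pointProj H x) := fun x y => by
    calc _ = (pointProj H y * diagonalOp H f hf) * T * pointProj H x -
          pointProj H y * T * (diagonalOp H f hf * pointProj H x) := by noncomm_ring
      _ = _ := by
        rw [← pointProj_mul_diagonalOp x f hf, pointProj_mul_diagonalOp_eq_smul,
          pointProj_mul_diagonalOp_eq_smul, smul_mul_assoc, smul_mul_assoc, mul_smul_comm,
          sub_smul]
  obtain ⟨F, hF⟩ := hbd R hR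
  refine IsLocallyCompactOp.isCompactOperator_of_finite (fun x y => ?_) F fun x y h => ?_
  · rw [hs]
    exact (hT x y).smul (f y - f x)
  · rw [hs] at h
    exact hF x y (hp x y (right_ne_zero_of_smul h)) fun hxy =>
      left_ne_zero_of_smul h (sub_eq_zero.2 hxy.symm)

/-- The rank of the projection is the dimension of `H`, so compactness must come from `T`: by finite
propagation and bounded geometry, a single column of `T` has finitely many entries, each compact.
The general case follows by taking limits. -/
theorem isCompactOperator_mul_pointProj (x₀ : X) {T : Op X H} (hT : T ∈ RoeAlgebra X H) :
    IsCompactOperator (T * pointProj H x₀ : Op X H) := by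
  refine closure_minimal (s := (algRoeAlgebra X H : Set (Op X H)))
    (t := {T | IsCompactOperator (T * pointProj H x₀ : Op X H)})
    ?_ (isClosed_setOfPred_isCompactOperator.preimage
      (f := fun T : Op X H => T * pointProj H x₀) (by fun_prop)) hT
  rintro T ⟨hT, R, hR, hp⟩
  change IsCompactOperator (T * pointProj H x₀ : Op X H)
  rw [mul_pointProj_eq_sum (T := T) x₀ (BoundedGeometry.finite_ball x₀ hR).toFinset
    (fun z hz => by simpa [dist_comm] using hp x₀ z hz)]
  exact isCompactOperator_sum _ fun z _ => hT x₀ z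

theorem isCompactOperator_pointProj_mul (x₀ : X) {T : Op X H} (hT : T ∈ RoeAlgebra X H) :
    IsCompactOperator (pointProj H x₀ * T : Op X H) := by
  have h := isCompactOperator_star (isCompactOperator_mul_pointProj x₀ (star_mem hT))
  rwa [star_mul, star_star, star_pointProj] at h

/-! ### Calculus of diagonal multipliers of the Roe corona -/

/-- Reduces identities of multipliers to identities of operators, exact or modulo compacts, on the
left and on the right. -/
theorem corona_multiplier_ext {M N : 𝓜(ℂ, RoeCorona X H)}
    (hl : ∀ a : RoeAlgebra X H, M.fst ((compactIdeal X H).mk a) = N.fst ((compactIdeal X H).mk a))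
    (hr : ∀ a : RoeAlgebra X H, M.snd ((compactIdeal X H).mk a) = N.snd ((compactIdeal X H).mk a)) :
    M = N := by
  refine DoubleCentralizer.ext _ _ _ _ (Prod.ext ?_ ?_) <;> ext x
  · obtain ⟨a, rfl⟩ := ClosedIdeal.mk_surjective x
    exact hl a
  · obtain ⟨a, rfl⟩ := ClosedIdeal.mk_surjective x
    exact hr a

theorem corona_mk_congr {a b : RoeAlgebra X H} (h : (a : Op X H) = b) :
    (compactIdeal X H).mk a = (compactIdeal X H).mk b := congrArg _ (Subtype.ext h)

/-- The class of a diagonal operator modulo the compacts does not depend on the entry at a single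
point. -/
theorem coronaDiagonal_congr_of_ne {f f' : X → ℂ} (hf : ∀ x, ‖f x‖ ≤ 1) (hf' : ∀ x, ‖f' x‖ ≤ 1)
    (x₀ : X) (h : ∀ x, x ≠ x₀ → f x = f' x) :
    (coronaDiagonal f hf : 𝓜(ℂ, RoeCorona X H)) = coronaDiagonal f' hf' := by
  refine corona_multiplier_ext (fun a => ?_) (fun a => ?_)
  · rw [coronaDiagonal_fst_mk, coronaDiagonal_fst_mk, ClosedIdeal.mk_eq_mk, mem_compactIdeal]
    change IsCompactOperator (diagonalOp H f hf * a - diagonalOp H f' hf' * a : Op X H)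
    -- The difference of the two diagonal operators need not be compact; only its product with the
    -- Roe algebra element `a` is.
    rw [← sub_mul, diagonalOp_sub_eq_smul_pointProj hf hf' x₀ h, smul_mul_assoc]
    exact (isCompactOperator_pointProj_mul x₀ a.2).smul (f x₀ - f' x₀)
  · rw [coronaDiagonal_snd_mk, coronaDiagonal_snd_mk, ClosedIdeal.mk_eq_mk, mem_compactIdeal]
    change IsCompactOperator (a * diagonalOp H f hf - a * diagonalOp H f' hf' : Op X H)
    rw [← mul_sub, diagonalOp_sub_eq_smul_pointProj hf hf' x₀ h, mul_smul_comm]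
    exact (isCompactOperator_mul_pointProj x₀ a.2).smul (f x₀ - f' x₀)

theorem coronaDiagonal_mul (f f' : X → ℂ) (hf : ∀ x, ‖f x‖ ≤ 1) (hf' : ∀ x, ‖f' x‖ ≤ 1) :
    (coronaDiagonal f hf * coronaDiagonal f' hf' : 𝓜(ℂ, RoeCorona X H)) =
      coronaDiagonal (fun x => f x * f' x)
        (fun x => by rw [norm_mul]; exact mul_le_one₀ (hf x) (norm_nonneg _) (hf' x)) := by
  refine corona_multiplier_ext (fun a => corona_mk_congr ?_) (fun a => corona_mk_congr ?_)
  · change diagonalOp H f hf * (diagonalOp H f' hf' * (a : Op X H)) = diagonalOp H _ _ * (a : Op X H)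
    rw [← mul_assoc, diagonalOp_mul_diagonalOp]
  · change (a : Op X H) * diagonalOp H f hf * diagonalOp H f' hf' = (a : Op X H) * diagonalOp H _ _
    rw [mul_assoc, diagonalOp_mul_diagonalOp]

theorem coronaDiagonal_smul (c : ℂ) (hc : ‖c‖ ≤ 1) (f : X → ℂ) (hf : ∀ x, ‖f x‖ ≤ 1) :
    (c • coronaDiagonal f hf : 𝓜(ℂ, RoeCorona X H)) = coronaDiagonal (fun x => c * f x)
      (fun x => by rw [norm_mul]; exact mul_le_one₀ hc (norm_nonneg _) (hf x)) := by
  have h : (c • diagonalOp H f hf : Op X H) = diagonalOp H (fun x => c * f x)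
      (fun x => by rw [norm_mul]; exact mul_le_one₀ hc (norm_nonneg _) (hf x)) := by
    ext η z
    exact smul_smul _ _ _
  -- The representative is given explicitly so that the scalar multiple of a class appears as the
  -- class of a scalar multiple.
  refine corona_multiplier_ext (fun a => corona_mk_congr
      (a := c • (⟨diagonalOp H f hf * a, diagonalOp_mul_mem f hf a.2⟩ : RoeAlgebra X H)) ?_)
    (fun a => corona_mk_congr
      (a := c • (⟨a * diagonalOp H f hf, mul_diagonalOp_mem f hf a.2⟩ : RoeAlgebra X H)) ?_)
  · change c • (diagonalOp H f hf * (a : Op X H)) = diagonalOp H _ _ * (a : Op X H)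
    rw [← h, smul_mul_assoc]
  · change c • ((a : Op X H) * diagonalOp H f hf) = (a : Op X H) * diagonalOp H _ _
    rw [← h, mul_smul_comm]

/-- The involution of double centralizers exchanges the two sides: the left action of the adjoint is
`a ↦ (a* D)*`, which equals `D* a`. -/
theorem star_coronaDiagonal (f : X → ℂ) (hf : ∀ x, ‖f x‖ ≤ 1) :
    star (coronaDiagonal f hf : 𝓜(ℂ, RoeCorona X H)) =
      coronaDiagonal (fun x => star (f x)) (by simpa using hf) := by
  refine corona_multiplier_ext (fun a => corona_mk_congr ?_) (fun a => corona_mk_congr ?_)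
  · change star (star (a : Op X H) * diagonalOp H f hf) = diagonalOp H _ _ * (a : Op X H)
    rw [star_mul, star_star, star_diagonalOp]
  · change star (diagonalOp H f hf * star (a : Op X H)) = (a : Op X H) * diagonalOp H _ _
    rw [star_mul, star_star, star_diagonalOp]

theorem coronaDiagonal_eq_one {f : X → ℂ} (hf : ∀ x, ‖f x‖ ≤ 1) (h : ∀ x, f x = 1) :
    (coronaDiagonal f hf : 𝓜(ℂ, RoeCorona X H)) = 1 := by
  have h1 : (diagonalOp H f hf : Op X H) = 1 := by
    ext η z
    rw [diagonalOp_apply, h, one_smul]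
    rfl
  refine corona_multiplier_ext (fun a => corona_mk_congr (b := a) ?_)
    (fun a => corona_mk_congr (b := a) ?_)
  · change diagonalOp H f hf * (a : Op X H) = a
    rw [h1, one_mul]
  · change (a : Op X H) * diagonalOp H f hf = a
    rw [h1, mul_one]

theorem coronaDiagonal_mem_unitary {f : X → ℂ} (hf : ∀ x, ‖f x‖ = 1) :
    (coronaDiagonal f (fun x => (hf x).le) : 𝓜(ℂ, RoeCorona X H)) ∈
      unitary 𝓜(ℂ, RoeCorona X H) := by
  have h : ∀ x, star (f x) * f x = 1 := fun x => by
    rw [Complex.star_def, Complex.conj_mul', hf, Complex.ofReal_one, one_pow]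
  rw [Unitary.mem_iff, star_coronaDiagonal, coronaDiagonal_mul, coronaDiagonal_mul]
  exact ⟨coronaDiagonal_eq_one _ h, coronaDiagonal_eq_one _ fun x => (mul_comm _ _).trans (h x)⟩

/-- The extension acts on the left by `a ↦ U D U* a U U*`, which is left multiplication by `U D U*`,
again diagonal. The right action is handled in the same way. -/
theorem multiplierExt_coronaConj_coronaDiagonal (σ : X ≃ᵢ X) (f : X → ℂ) (hf : ∀ x, ‖f x‖ ≤ 1) :
    multiplierExt (coronaConj σ) (coronaDiagonal f hf : 𝓜(ℂ, RoeCorona X H)) =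
      coronaDiagonal (fun x => f (σ.symm x)) (fun _ => hf _) := by
  have h1 := permOp_mul_diagonalOp (H := H) σ.toEquiv f hf
  have h2 := permOp_mul_symm (H := H) σ.toEquiv
  refine corona_multiplier_ext (fun a => corona_mk_congr ?_) (fun a => corona_mk_congr ?_)
  · change permOp H σ.toEquiv * (diagonalOp H f hf * (permOp H σ.toEquiv.symm * (a : Op X H) *
      star (permOp H σ.toEquiv.symm))) * star (permOp H σ.toEquiv) = diagonalOp H _ _ * (a : Op X H)
    rw [star_permOp, star_permOp, Equiv.symm_symm]
    calc _ = (permOp H σ.toEquiv * diagonalOp H f hf) * permOp H σ.toEquiv.symm * (a : Op X H) *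
          (permOp H σ.toEquiv * permOp H σ.toEquiv.symm) := by simp only [mul_assoc]
      _ = _ := by rw [h1, mul_assoc (diagonalOp H _ _), h2, mul_one, mul_one]; rfl
  · change permOp H σ.toEquiv * ((permOp H σ.toEquiv.symm * (a : Op X H) *
      star (permOp H σ.toEquiv.symm)) * diagonalOp H f hf) * star (permOp H σ.toEquiv) =
        (a : Op X H) * diagonalOp H _ _
    rw [star_permOp, star_permOp, Equiv.symm_symm]
    calc _ = (permOp H σ.toEquiv * permOp H σ.toEquiv.symm) * (a : Op X H) *
          ((permOp H σ.toEquiv * diagonalOp H f hf) * permOp H σ.toEquiv.symm) := by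
          simp only [mul_assoc]
      _ = _ := by rw [h1, h2, one_mul, mul_assoc (diagonalOp H _ _), h2, mul_one]; rfl

/-- Permutation operators compose without any phase, so the anomaly comes from the diagonal
multipliers alone. -/
theorem coronaConj_coronaConj (σ τ : X ≃ᵢ X) (x : RoeCorona X H) :
    coronaConj σ (coronaConj τ x) = coronaConj (τ.trans σ) x := by
  obtain ⟨a, rfl⟩ := ClosedIdeal.mk_surjective x
  refine corona_mk_congr ?_
  change permOp H σ.toEquiv * (permOp H τ.toEquiv * (a : Op X H) * star (permOp H τ.toEquiv)) *
    star (permOp H σ.toEquiv) = permOp H (τ.toEquiv.trans σ.toEquiv) * (a : Op X H) *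
      star (permOp H (τ.toEquiv.trans σ.toEquiv))
  rw [← permOp_mul_permOp, star_mul]
  simp only [mul_assoc]

/-- A diagonal operator that commutes with the Roe algebra modulo the compacts is a central
multiplier of the Roe corona. -/
theorem coronaDiagonal_mul_coe_comm (f : X → ℂ) (hf : ∀ x, ‖f x‖ ≤ 1)
    (hbd : ∀ R : ℝ, 0 < R → ∃ F : Finset X, ∀ x y, dist x y < R → f x ≠ f y → x ∈ F ∧ y ∈ F)
    (b : RoeCorona X H) :
    coronaDiagonal f hf * (b : 𝓜(ℂ, RoeCorona X H)) =
      (b : 𝓜(ℂ, RoeCorona X H)) * coronaDiagonal f hf := by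
  obtain ⟨b, rfl⟩ := ClosedIdeal.mk_surjective b
  have hb := isCompactOperator_commutator_diagonalOp f hf hbd b.2
  refine corona_multiplier_ext (fun a => ?_) (fun a => ?_)
  -- With `D` the diagonal operator, the left actions on `a` differ by `[D, b] a`.
  · refine ClosedIdeal.mk_eq_mk
      (a := ⟨diagonalOp H f hf * ((b : Op X H) * a), diagonalOp_mul_mem f hf (b * a).2⟩)
      (b := b * ⟨diagonalOp H f hf * a, diagonalOp_mul_mem f hf a.2⟩) |>.2 ?_
    change IsCompactOperator
      (diagonalOp H f hf * ((b : Op X H) * a) - (b : Op X H) * (diagonalOp H f hf * a) : Op X H)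
    rw [← mul_assoc, ← mul_assoc, ← sub_mul]
    exact isCompactOperator_mul_right hb _
  -- Right actions compose in the opposite order, and their difference is `a [D, b]`.
  · refine ClosedIdeal.mk_eq_mk
      (a := ⟨(a : Op X H) * diagonalOp H f hf, mul_diagonalOp_mem f hf a.2⟩ * b)
      (b := ⟨((a : Op X H) * b) * diagonalOp H f hf, mul_diagonalOp_mem f hf (a * b).2⟩) |>.2 ?_
    change IsCompactOperator
      ((a : Op X H) * diagonalOp H f hf * b - (a : Op X H) * b * diagonalOp H f hf : Op X H)
    rw [mul_assoc, mul_assoc, ← mul_sub]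
    exact isCompactOperator_mul_left hb _

end Roe

/-! ### Phases on the wedge and the anomalous action. -/

namespace Wedge

variable {G : Type*} [Group G] {Y : Type*} [MetricSpace Y] {y₀ : Y}

theorem norm_phase (ω : G → G → G → Circle) (g h : G) (x : Wedge G y₀) :
    ‖phase ω g h x‖ = 1 := by
  match x with
  | base => exact norm_one
  | pt k y hy => exact Circle.norm_coe _

/-- Points with distinct phases lie on distinct branches, so their distance is at least that of
either of them to the base point. -/
theorem dist_base_le_of_phase_ne (ω : G → G → G → Circle) (g h : G) {a b : Wedge G y₀}
    (hab : phase ω g h a ≠ phase ω g h b) : dist a base ≤ dist a b ∧ dist b base ≤ dist a b := by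
  match a, b with
  | base, base => exact absurd rfl hab
  | base, pt k y hy => exact ⟨by rw [dist_self]; exact dist_nonneg, (dist_comm _ _).le⟩
  | pt k x hx, base => exact ⟨le_rfl, by rw [dist_self]; exact dist_nonneg⟩
  | pt k x hx, pt l y hy =>
    -- The phase sees only the label of the branch, not the point on it.
    have hkl : k ≠ l := by
      rintro rfl
      exact hab rfl
    rw [dist_pt_ne hkl, dist_pt_base, dist_pt_base, dist_comm y₀ y]
    exact ⟨le_add_of_nonneg_right dist_nonneg, le_add_of_nonneg_left dist_nonneg⟩

/-- The `R`-ball about the base point serves as the finite set; this supplies the hypothesis of the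
commutator criterion. -/
theorem exists_finset_of_phase_ne [Finite G] [BoundedGeometry Y] (ω : G → G → G → Circle) (g h : G)
    (R : ℝ) (hR : 0 < R) : ∃ F : Finset (Wedge G y₀), ∀ a b, dist a b < R →
      phase ω g h a ≠ phase ω g h b → a ∈ F ∧ b ∈ F := by
  refine ⟨(BoundedGeometry.finite_ball base hR).toFinset, fun a b hd hab => ?_⟩
  have := dist_base_le_of_phase_ne ω g h hab
  simp only [Set.Finite.mem_toFinset, Metric.mem_ball]
  exact ⟨this.1.trans_lt hd, this.2.trans_lt hd⟩

/-- Away from the base point, the phases satisfy the anomaly relation. -/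
theorem phase_anomaly {ω : G → G → G → Circle} (hω : IsNormalizedThreeCocycle ω) (g h k : G)
    (x : Wedge G y₀) (hx : x ≠ base) :
    (ω g h k : ℂ) * (phase ω (g * h) k x * phase ω g h x) =
      phase ω g (h * k) x * phase ω h k (g⁻¹ • x) := by
  match x, hx with
  | pt l y hy, _ =>
    -- Put `j = (ghk)⁻¹ l`. On the branch `l` the four phases are the inverses of `ω(gh,k,j)`,
    -- `ω(g,h,kj)`, `ω(g,hk,j)` and `ω(h,k,j)`, so the cocycle identity with fourth argument `j` is
    -- what is needed.
    have hc := hω.cocycle g h k ((g * h * k)⁻¹ * l)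
    rw [smul_pt]
    simp only [phase]
    rw [← Circle.coe_mul, ← Circle.coe_mul, ← Circle.coe_mul]
    congr 1
    rw [show k⁻¹ * (g * h)⁻¹ * l = (g * h * k)⁻¹ * l by group,
      show h⁻¹ * g⁻¹ * l = k * ((g * h * k)⁻¹ * l) by group,
      show (h * k)⁻¹ * g⁻¹ * l = (g * h * k)⁻¹ * l by group,
      show k⁻¹ * h⁻¹ * (g⁻¹ * l) = (g * h * k)⁻¹ * l by group, ← mul_inv, ← mul_inv, ← hc,
      mul_inv, mul_inv, mul_inv, mul_comm (ω g h k), inv_mul_cancel_right, mul_comm]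

variable (H : Type*) [NormedAddCommGroup H] [InnerProductSpace ℂ H] [CompleteSpace H]
  [Finite G] [BoundedGeometry Y]

variable (y₀) in
theorem isAnomalousAction_alpha_mult {ω : G → G → G → Circle} (hω : IsNormalizedThreeCocycle ω) :
    IsAnomalousAction (B := RoeCorona (Wedge G y₀) H) ω
      (fun g => alpha y₀ H g) (fun g h => mult y₀ H ω g h) where
  unitary g h := coronaDiagonal_mem_unitary (norm_phase ω g h)
  intertwine g h x := by
    have hgh : alpha y₀ H g (alpha y₀ H h x) = alpha y₀ H (g * h) x := by
      rw [alpha, alpha, coronaConj_coronaConj, alpha]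
      -- It remains to compare two isometries of the wedge, which agree because `G` acts on it.
      congr 2
      ext z
      exact (mul_smul g h z).symm
    rw [hgh]
    -- With `α_g α_h = α_{gh}` inserted, the relation is centrality of the multiplier.
    exact coronaDiagonal_mul_coe_comm _ _ (exists_finset_of_phase_ne ω g h) _
  anomaly g h k := by
    simp only [mult, alpha]
    rw [multiplierExt_coronaConj_coronaDiagonal, coronaDiagonal_mul, coronaDiagonal_mul,
      coronaDiagonal_smul _ (Circle.norm_coe _).le]
    -- Both sides are now single diagonal multipliers, and their entries may disagree at the base
    -- point.
    exact coronaDiagonal_congr_of_ne _ _ base fun x hx => phase_anomaly hω g h k x hx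

end Wedge

end Coarse

theorem mainTheorem12 {G : Type*} [Group G] [Finite G] (ω : G → G → G → Circle)
    (hω : Coarse.IsNormalizedThreeCocycle ω)
    {Y : Type*} [MetricSpace Y] [Coarse.BoundedGeometry Y] (y₀ : Y)
    {H : Type*} [NormedAddCommGroup H] [InnerProductSpace ℂ H] [CompleteSpace H]
    [TopologicalSpace.SeparableSpace H] (hH : ¬ FiniteDimensional ℂ H) :
    Coarse.IsAnomalousAction (B := Coarse.RoeCorona (Coarse.Wedge G y₀) H) ω
      (fun g => Coarse.Wedge.alpha y₀ H g) (fun g h => Coarse.Wedge.mult y₀ H ω g h) ∧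
    Coarse.IsAnomalousAction (B := Coarse.UniformRoeCorona (Coarse.Wedge G y₀)) ω
      (fun g => Coarse.Wedge.alpha y₀ ℂ g) (fun g h => Coarse.Wedge.mult y₀ ℂ ω g h) :=
  ⟨Coarse.Wedge.isAnomalousAction_alpha_mult y₀ H hω,
    Coarse.Wedge.isAnomalousAction_alpha_mult y₀ ℂ hω⟩
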